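/- **Theorem 5.1.** Let $\mathcal{A}$ be an alphabet with $d\ge 2$ letters. A combinatorial datum over $\mathcal{A}$ is a pair $\pi=(\pi^t,\pi^b)$ of bijections $\mathcal{A}\to\{1,\dots,d\}$, giving the position of each letter in the top row and in the bottom row; it is admissible if there are no $0<k<d$ and $\mathcal{A}'\subset\mathcal{A}$ with $\pi^t(\mathcal{A}')=\pi^b(\mathcal{A}')=\{1,\dots,k\}$. The operation $R^t$ keeps the top row of $\pi$ and moves the last letter of the bottom row to the place right after the letter $\alpha_t$ of the bottom row, where $\pi^t(\alpha_t)=d$; the operation $R^b$ is obtained by exchanging the roles of the two rows. A Rauzy class over $\mathcal{A}$ is a minimal non-empty set of admissible combinatorial data over $\mathcal{A}$ that is invariant under $R^t$ and $R^b$. All elements $\pi$ of a Rauzy class have the same first letter $X$ in the top row ($\pi^t(X)=1$) and the same first letter $Y$ in the bottom row ($\pi^b(Y)=1$). Let $\mathcal{R}$ be any Rauzy class over $\mathcal{A}$, with first letters $X$ and $Y$ as above, and let $(\beta,\alpha)$ be any ordered pair of letters of $\mathcal{A}$ (possibly equal) with $\beta\neq Y$ and $\alpha\neq X$. Then at least one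 of the following two statements holds. **A:** There exists $\pi\in\mathcal{R}$ such that $\pi^t(\alpha)=\pi^b(\beta)=d$. **B:** There exist two different elements $\pi,\pi'\in\mathcal{R}$ and two letters $V,V'\in\mathcal{A}$ such that $$\{\xi\in\mathcal{A}:\pi^t(\xi)<\pi^t(\alpha)\}\cup\{V\}=\{\xi\in\mathcal{A}:\pi^b(\xi)<\pi^b(\beta)\},\qquad \pi^t(V)=\pi^b(\alpha)=d,$$ and $$\{\xi\in\mathcal{A}:\pi'^t(\xi)<\pi'^t(\alpha)\}=\{\xi\in\mathcal{A}:\pi'^b(\xi)<\pi'^b(\beta)\}\cup\{V'\},\qquad \pi'^b(V')=\pi'^t(\beta)=d.$$ -/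

import Mathlib

/-- A combinatorial datum over the alphabet `A` with `d ≥ 2` letters: a pair of bijections from
`A` to the `d` positions of the top and of the bottom row. In `Fin d` positions are counted from
`0`; `CombDatum.t` and `CombDatum.b` below count them from `1` to `d`. -/
@[ext]
structure CombDatum (A : Type*) (d : ℕ) where
  top : A ≃ Fin d
  bot : A ≃ Fin d
  two_le : 2 ≤ d

/-- For a position `k`, the bijection of the positions that fixes every position `p ≤ k`, sends the
last position to the one right after `k`, and moves every other `p > k` one step to the right. (It
is the identity if `k` is itself the last position.) -/
def insertAfter {d : ℕ} (k : Fin d) : Fin d ≃ Fin d where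
  toFun p :=
    if h : p.1 ≤ k.1 then p
    else if h' : p.1 + 1 = d then ⟨k.1 + 1, by omega⟩
    else ⟨p.1 + 1, by omega⟩
  invFun q :=
    if h : q.1 ≤ k.1 then q
    else if h' : q.1 = k.1 + 1 then ⟨d - 1, by omega⟩
    else ⟨q.1 - 1, by omega⟩
  left_inv p := by
    ext
    grind
  right_inv q := by
    ext
    grind

namespace CombDatum

variable {A : Type*} {d : ℕ}

/-- The position `π^t(ξ) ∈ {1, …, d}` of the letter `ξ` in the top row. -/
def t (π : CombDatum A d) (ξ : A) : ℕ := (π.top ξ : ℕ) + 1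

/-- The position `π^b(ξ) ∈ {1, …, d}` of the letter `ξ` in the bottom row. -/
def b (π : CombDatum A d) (ξ : A) : ℕ := (π.bot ξ : ℕ) + 1

/-- No set of `k` letters with `0 < k < d` occupies the first `k` positions of both rows. -/
def Admissible (π : CombDatum A d) : Prop :=
  ¬ ∃ k : ℕ, 0 < k ∧ k < d ∧ ∃ S : Set A, π.t '' S = Set.Icc 1 k ∧ π.b '' S = Set.Icc 1 k

/-- The last position of a row. -/
def lastPos (π : CombDatum A d) : Fin d := ⟨d - 1, by have := π.two_le; omega⟩

/-- The last letter of the top row. -/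
def lastTop (π : CombDatum A d) : A := π.top.symm π.lastPos

/-- The last letter of the bottom row. -/
def lastBot (π : CombDatum A d) : A := π.bot.symm π.lastPos

/-- The elementary operation `R^t`: the top row is kept, and in the bottom row the last letter
is moved to the place right after the last letter of the top row. -/
def rauzyTop (π : CombDatum A d) : CombDatum A d where
  top := π.top
  bot := π.bot.trans (insertAfter (π.bot π.lastTop))
  two_le := π.two_le

/-- The elementary operation `R^b`: the bottom row is kept, and in the top row the last letter
is moved to the place right after the last letter of the bottom row. -/
def rauzyBot (π : CombDatum A d) : CombDatum A d where
  top := π.top.trans (insertAfter (π.top π.lastBot))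
  bot := π.bot
  two_le := π.two_le

end CombDatum

/-- A Rauzy class: a minimal non-empty set of admissible combinatorial data that is invariant
under both elementary operations. -/
def IsRauzyClass {A : Type*} {d : ℕ} (R : Set (CombDatum A d)) : Prop :=
  Minimal (fun S : Set (CombDatum A d) =>
    S.Nonempty ∧ (∀ π ∈ S, π.Admissible) ∧ ∀ π ∈ S, π.rauzyTop ∈ S ∧ π.rauzyBot ∈ S) R

theorem insertAfter_eq_zero {d : ℕ} (k p : Fin d) (hp : (p : ℕ) = 0) :
    (insertAfter k p : ℕ) = 0 := by
  have h : (p : ℕ) ≤ k := by omega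
  show ((if h : p.1 ≤ k.1 then p else _ : Fin d) : ℕ) = 0
  rw [dif_pos h, hp]

/-- All elements of a Rauzy class have the same first letter in the top row, so that the letter
`X` of a Rauzy class is well defined. -/
theorem IsRauzyClass.existsUnique_first_top {A : Type*} {d : ℕ} {R : Set (CombDatum A d)}
    (hR : IsRauzyClass R) : ∃! X : A, ∀ π ∈ R, π.t X = 1 := by
  obtain ⟨⟨⟨π₀, h₀⟩, hadm, hinv⟩, hmin⟩ := hR
  have hd := π₀.two_le
  refine ⟨π₀.top.symm ⟨0, by omega⟩, ?_, ?_⟩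
  · have hsub := hmin (y := {π ∈ R | π.t (π₀.top.symm ⟨0, by omega⟩) = 1})
      ⟨⟨π₀, h₀, by simp [CombDatum.t]⟩, fun π h => hadm π h.1, fun π h =>
        ⟨⟨(hinv π h.1).1, h.2⟩, ⟨(hinv π h.1).2, by
          have h2 := h.2
          simp only [CombDatum.t, CombDatum.rauzyBot, Equiv.trans_apply] at h2 ⊢
          rw [insertAfter_eq_zero _ _ (by omega)]⟩⟩⟩ (fun π h => h.1)
    exact fun π h => (hsub h).2
  · intro Z hZ
    have h := hZ π₀ h₀
    rw [Equiv.eq_symm_apply]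
    ext
    simp only [CombDatum.t] at h ⊢
    omega

/-- All elements of a Rauzy class have the same first letter in the bottom row, so that the letter
`Y` of a Rauzy class is well defined. -/
theorem IsRauzyClass.existsUnique_first_bot {A : Type*} {d : ℕ} {R : Set (CombDatum A d)}
    (hR : IsRauzyClass R) : ∃! Y : A, ∀ π ∈ R, π.b Y = 1 := by
  obtain ⟨⟨⟨π₀, h₀⟩, hadm, hinv⟩, hmin⟩ := hR
  have hd := π₀.two_le
  refine ⟨π₀.bot.symm ⟨0, by omega⟩, ?_, ?_⟩
  · have hsub := hmin (y := {π ∈ R | π.b (π₀.bot.symm ⟨0, by omega⟩) = 1})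
      ⟨⟨π₀, h₀, by simp [CombDatum.b]⟩, fun π h => hadm π h.1, fun π h =>
        ⟨⟨(hinv π h.1).1, by
          have h2 := h.2
          simp only [CombDatum.b, CombDatum.rauzyTop, Equiv.trans_apply] at h2 ⊢
          rw [insertAfter_eq_zero _ _ (by omega)]⟩, ⟨(hinv π h.1).2, h.2⟩⟩⟩ (fun π h => h.1)
    exact fun π h => (hsub h).2
  · intro Z hZ
    have h := hZ π₀ h₀
    rw [Equiv.eq_symm_apply]
    ext
    simp only [CombDatum.b] at h ⊢
    omega

/-! Let P be the letters before `α` in the top row and Q those before `β` in the bottom row. If A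
fails, it suffices to reach P ∪ {V} = Q with V last on top and `α` last below (`exists_nested`);
exchanging the rows gives the other half of B.

Some datum in the class is crossing, i.e. P and Q are not nested: otherwise one inclusion would
persist through the class, contradicting that `Y` is somewhere last on top, or `X` last below. In a
crossing datum with (position of `α`, position of `β`) lexicographically maximal, suitably chosen, Q
\ P is just the last top letter x and P \ Q just the last bottom letter y
(`exists_maximal_crossing`). One `R^t` puts y behind x, so Q = P ∪ {x}.

It remains to make `α` last below and x last on top without touching these prefixes. If the rows
split again further right, a detour produces a crossing datum with `α` further right, against
maximality (`exists_crossing_of_prefix`). If they do not, `ClosedExcept.exists_lastBot_eq` applies: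
it is the argument that letters other than the first become last, run on a minimal set where `R^t`
is not required when x is last on top. -/

namespace CombDatum

variable {A : Type*} {d : ℕ}

/-! ### The operations and their iterates in coordinates -/

theorem eq_lastTop_iff (π : CombDatum A d) (a : A) : a = π.lastTop ↔ (π.top a : ℕ) + 1 = d := by
  have := π.two_le
  rw [lastTop, Equiv.eq_symm_apply, Fin.ext_iff, lastPos]
  have := (π.top a).2
  simp only
  omega

theorem eq_lastBot_iff (π : CombDatum A d) (a : A) : a = π.lastBot ↔ (π.bot a : ℕ) + 1 = d := by
  have := π.two_le
  rw [lastBot, Equiv.eq_symm_apply, Fin.ext_iff, lastPos]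
  have := (π.bot a).2
  simp only
  omega

theorem top_lastTop (π : CombDatum A d) : (π.top π.lastTop : ℕ) + 1 = d :=
  (π.eq_lastTop_iff _).1 rfl

theorem bot_lastBot (π : CombDatum A d) : (π.bot π.lastBot : ℕ) + 1 = d :=
  (π.eq_lastBot_iff _).1 rfl

theorem top_inj (π : CombDatum A d) {a c : A} (h : (π.top a : ℕ) = π.top c) : a = c :=
  π.top.injective (Fin.ext h)

theorem bot_inj (π : CombDatum A d) {a c : A} (h : (π.bot a : ℕ) = π.bot c) : a = c :=
  π.bot.injective (Fin.ext h)

theorem exists_bot (π : CombDatum A d) {k : ℕ} (h : k < d) : ∃ a, (π.bot a : ℕ) = k :=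
  ⟨π.bot.symm ⟨k, h⟩, by simp⟩

theorem bot_rauzyTop (π : CombDatum A d) (a : A) :
    (π.rauzyTop.bot a : ℕ) =
      if (π.bot a : ℕ) ≤ π.bot π.lastTop then (π.bot a : ℕ)
      else if (π.bot a : ℕ) + 1 = d then (π.bot π.lastTop : ℕ) + 1 else (π.bot a : ℕ) + 1 := by
  simp only [rauzyTop, Equiv.trans_apply, insertAfter, Equiv.coe_fn_mk]
  split_ifs <;> rfl

theorem top_rauzyBot (π : CombDatum A d) (a : A) :
    (π.rauzyBot.top a : ℕ) =
      if (π.top a : ℕ) ≤ π.top π.lastBot then (π.top a : ℕ)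
      else if (π.top a : ℕ) + 1 = d then (π.top π.lastBot : ℕ) + 1 else (π.top a : ℕ) + 1 := by
  simp only [rauzyBot, Equiv.trans_apply, insertAfter, Equiv.coe_fn_mk]
  split_ifs <;> rfl

theorem top_rauzyTop (π : CombDatum A d) : π.rauzyTop.top = π.top := rfl

theorem bot_rauzyBot (π : CombDatum A d) : π.rauzyBot.bot = π.bot := rfl

theorem lastTop_rauzyTop (π : CombDatum A d) : π.rauzyTop.lastTop = π.lastTop := rfl

theorem top_iterate_rauzyTop (π : CombDatum A d) (j : ℕ) : (rauzyTop^[j] π).top = π.top := by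
  induction j with
  | zero => rfl
  | succ j ih => rw [Function.iterate_succ_apply', top_rauzyTop, ih]

/-- `R^t` rotates cyclically the block behind the last top letter, which itself stays put. The bound
on `j` allows at most one full turn, so a single wrap-around term suffices. -/
theorem bot_iterate_rauzyTop (π : CombDatum A d) (a : A) (j : ℕ)
    (hj : j + π.bot π.lastTop + 1 ≤ d) :
    ((rauzyTop^[j] π).bot a : ℕ) =
      if (π.bot a : ℕ) ≤ π.bot π.lastTop then (π.bot a : ℕ)
      else if (π.bot a : ℕ) + j < d then (π.bot a : ℕ) + j
      else (π.bot a : ℕ) + j + π.bot π.lastTop + 1 - d := by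
  induction j generalizing a with
  | zero => have := (π.bot a).2; simp
  | succ j ih =>
    have hl : (rauzyTop^[j] π).lastTop = π.lastTop := by
      simp only [lastTop, lastPos, top_iterate_rauzyTop]
    have h1 := ih a (by omega)
    have h2 := ih π.lastTop (by omega)
    have := (π.bot a).2
    rw [Function.iterate_succ_apply', bot_rauzyTop, hl, h1, h2]
    split_ifs <;> omega

/-- Exchange of the two rows. -/
def swap (π : CombDatum A d) : CombDatum A d := ⟨π.bot, π.top, π.two_le⟩

theorem swap_iterate_rauzyBot (π : CombDatum A d) (j : ℕ) :
    rauzyBot^[j] π = (rauzyTop^[j] π.swap).swap := by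
  induction j with
  | zero => rfl
  | succ j ih => rw [Function.iterate_succ_apply', Function.iterate_succ_apply', ih]; rfl

theorem bot_iterate_rauzyBot (π : CombDatum A d) (j : ℕ) : (rauzyBot^[j] π).bot = π.bot := by
  rw [swap_iterate_rauzyBot]
  exact top_iterate_rauzyTop π.swap j

theorem top_iterate_rauzyBot (π : CombDatum A d) (a : A) (j : ℕ)
    (hj : j + π.top π.lastBot + 1 ≤ d) :
    ((rauzyBot^[j] π).top a : ℕ) =
      if (π.top a : ℕ) ≤ π.top π.lastBot then (π.top a : ℕ)
      else if (π.top a : ℕ) + j < d then (π.top a : ℕ) + j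
      else (π.top a : ℕ) + j + π.top π.lastBot + 1 - d := by
  rw [swap_iterate_rauzyBot]
  exact bot_iterate_rauzyTop π.swap a j hj

theorem image_add_one_prefix (e : A ≃ Fin d) {k : ℕ} (hk : k ≤ d) :
    (fun a => (e a : ℕ) + 1) '' {a | (e a : ℕ) < k} = Set.Icc 1 k := by
  ext n
  simp only [Set.mem_image, Set.mem_ofPred_eq, Set.mem_Icc]
  constructor
  · rintro ⟨a, ha, rfl⟩
    omega
  · rintro ⟨h1, h2⟩
    exact ⟨e.symm ⟨n - 1, by omega⟩, by simp; omega, by simp; omega⟩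

theorem Admissible.not_prefix {π : CombDatum A d} (h : π.Admissible) {k : ℕ} (h0 : 0 < k)
    (hd : k < d) : ¬ ∀ a, (π.bot a : ℕ) < k ↔ (π.top a : ℕ) < k := by
  intro H
  refine h ⟨k, h0, hd, {a | (π.top a : ℕ) < k}, image_add_one_prefix π.top hd.le, ?_⟩
  simp_rw [← H]
  exact image_add_one_prefix π.bot hd.le

theorem Admissible.swap {π : CombDatum A d} (h : π.Admissible) : π.swap.Admissible := by
  rintro ⟨k, h0, hd, S, h1, h2⟩
  exact h ⟨k, h0, hd, S, h2, h1⟩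

theorem Admissible.lastTop_ne_lastBot {π : CombDatum A d} (h : π.Admissible) :
    π.lastTop ≠ π.lastBot := by
  intro e
  have hd := π.two_le
  refine h.not_prefix (k := d - 1) (by omega) (by omega) fun a => ?_
  have h1 := π.eq_lastTop_iff a
  have h2 := π.eq_lastBot_iff a
  rw [← e, h1] at h2
  have := (π.top a).2
  have := (π.bot a).2
  omega

theorem card_prefix [Fintype A] (e : A ≃ Fin d) {k : ℕ} (hk : k ≤ d) :
    (Finset.univ.filter fun a => (e a : ℕ) < k).card = k := by
  rw [Finset.card_equiv e (t := Finset.univ.filter fun i : Fin d => (i : ℕ) < k) (by simp),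
    Fin.card_filter_val_lt, min_eq_right hk]

/-- Finiteness provides minimal closed subsets inside a given closed set. -/
instance instFinite [Finite A] : Finite (CombDatum A d) :=
  Finite.of_injective (fun π => (π.top, π.bot)) fun π π' h => by
    simp only [Prod.mk.injEq] at h
    exact CombDatum.ext h.1 h.2

end CombDatum

/-! ### Rauzy classes and minimal closed sets -/

section

open CombDatum

variable {A : Type*} {d : ℕ}

theorem IsRauzyClass.swap {R : Set (CombDatum A d)} (hR : IsRauzyClass R) :
    IsRauzyClass (CombDatum.swap ⁻¹' R) := by
  obtain ⟨⟨⟨π₀, h₀⟩, hadm, hinv⟩, hmin⟩ := hR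
  refine ⟨⟨⟨π₀.swap, h₀⟩, fun π h => (hadm _ h).swap, fun π h => ⟨(hinv _ h).2, (hinv _ h).1⟩⟩, ?_⟩
  rintro S ⟨⟨π₁, h₁⟩, hadm', hinv'⟩ hS π hπ
  exact hmin (y := CombDatum.swap ⁻¹' S)
    ⟨⟨π₁.swap, h₁⟩, fun π h => (hadm' _ h).swap, fun π h => ⟨(hinv' _ h).2, (hinv' _ h).1⟩⟩
    (fun π h => hS h) hπ

theorem IsRauzyClass.rauzyTop_mem {R : Set (CombDatum A d)} (hR : IsRauzyClass R)
    {π : CombDatum A d} (h : π ∈ R) : π.rauzyTop ∈ R := (hR.prop.2.2 π h).1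

theorem IsRauzyClass.rauzyBot_mem {R : Set (CombDatum A d)} (hR : IsRauzyClass R)
    {π : CombDatum A d} (h : π ∈ R) : π.rauzyBot ∈ R := (hR.prop.2.2 π h).2

theorem IsRauzyClass.iterate_rauzyTop_mem {R : Set (CombDatum A d)} (hR : IsRauzyClass R)
    {π : CombDatum A d} (h : π ∈ R) (j : ℕ) : rauzyTop^[j] π ∈ R := by
  induction j with
  | zero => exact h
  | succ j ih => rw [Function.iterate_succ_apply']; exact hR.rauzyTop_mem ih

theorem IsRauzyClass.iterate_rauzyBot_mem {R : Set (CombDatum A d)} (hR : IsRauzyClass R)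
    {π : CombDatum A d} (h : π ∈ R) (j : ℕ) : rauzyBot^[j] π ∈ R := by
  induction j with
  | zero => exact h
  | succ j ih => rw [Function.iterate_succ_apply']; exact hR.rauzyBot_mem ih

theorem IsRauzyClass.admissible {R : Set (CombDatum A d)} (hR : IsRauzyClass R)
    {π : CombDatum A d} (h : π ∈ R) : π.Admissible := hR.prop.2.1 π h

/-- A property that holds somewhere in a Rauzy class and is preserved by both operations holds on
the whole class. -/
theorem IsRauzyClass.forall_of_exists {R : Set (CombDatum A d)} (hR : IsRauzyClass R)
    {p : CombDatum A d → Prop} (h₀ : ∃ π ∈ R, p π)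
    (h : ∀ π ∈ R, p π → p π.rauzyTop ∧ p π.rauzyBot) : ∀ π ∈ R, p π := by
  have := hR.2 (y := {π ∈ R | p π}) ⟨h₀, fun π h => hR.admissible h.1, fun π hπ =>
    ⟨⟨hR.rauzyTop_mem hπ.1, (h π hπ.1 hπ.2).1⟩, ⟨hR.rauzyBot_mem hπ.1, (h π hπ.1 hπ.2).2⟩⟩⟩
    (fun π h => h.1)
  exact fun π hπ => (this hπ).2

/-- Invariance under `R^b`, and under `R^t` unless the last top letter lies in `E`. -/
def ClosedExcept (E : Set A) (M : Set (CombDatum A d)) : Prop :=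
  M.Nonempty ∧ ∀ π ∈ M, π.rauzyBot ∈ M ∧ (π.lastTop ∉ E → π.rauzyTop ∈ M)

theorem ClosedExcept.forall_of_exists {E : Set A} {M : Set (CombDatum A d)}
    (hM : Minimal (ClosedExcept E) M) {p : CombDatum A d → Prop} (h₀ : ∃ π ∈ M, p π)
    (h : ∀ π ∈ M, p π → p π.rauzyBot ∧ (π.lastTop ∉ E → p π.rauzyTop)) : ∀ π ∈ M, p π := by
  have := hM.2 (y := {π ∈ M | p π}) ⟨h₀, fun π hπ =>
    ⟨⟨(hM.1.2 π hπ.1).1, (h π hπ.1 hπ.2).1⟩,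
      fun hl => ⟨(hM.1.2 π hπ.1).2 hl, (h π hπ.1 hπ.2).2 hl⟩⟩⟩ (fun π h => h.1)
  exact fun π hπ => (this hπ).2

/-- On a minimal set, a letter that is never the last one of the bottom row does not move there. -/
theorem ClosedExcept.bot_const {E : Set A} {M : Set (CombDatum A d)}
    (hM : Minimal (ClosedExcept E) M) {u : A} (hu : ∀ π ∈ M, u ≠ π.lastBot) :
    ∃ m, ∀ π ∈ M, (π.bot u : ℕ) = m := by
  obtain ⟨π₀, h₀, hmax⟩ : ∃ π₀ ∈ M, ∀ π ∈ M, (π.bot u : ℕ) ≤ π₀.bot u := by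
    have := WellFounded.has_min (measure fun π : CombDatum A d => d - (π.bot u : ℕ)).wf M hM.1.1
    obtain ⟨π₀, h₀, h⟩ := this
    refine ⟨π₀, h₀, fun π hπ => ?_⟩
    have h1 : ¬ d - (π.bot u : ℕ) < d - (π₀.bot u : ℕ) := h π hπ
    omega
  -- A letter that is not last can only stay or move right, so it cannot leave its maximal position.
  refine ⟨π₀.bot u, ClosedExcept.forall_of_exists hM ⟨π₀, h₀, rfl⟩ fun π hπ hp => ⟨hp, fun hl => ?_⟩⟩
  have h1 := hmax _ ((hM.1.2 π hπ).2 hl)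
  have h2 := hu π hπ
  rw [Ne, eq_lastBot_iff] at h2
  rw [bot_rauzyTop] at *
  split_ifs at * <;> omega

theorem ClosedExcept.top_const {E : Set A} {M : Set (CombDatum A d)}
    (hM : Minimal (ClosedExcept E) M) {u : A} (hu : ∀ π ∈ M, u ≠ π.lastTop) :
    ∃ m, ∀ π ∈ M, (π.top u : ℕ) = m := by
  obtain ⟨π₀, h₀, hmax⟩ : ∃ π₀ ∈ M, ∀ π ∈ M, (π.top u : ℕ) ≤ π₀.top u := by
    have := WellFounded.has_min (measure fun π : CombDatum A d => d - (π.top u : ℕ)).wf M hM.1.1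
    obtain ⟨π₀, h₀, h⟩ := this
    refine ⟨π₀, h₀, fun π hπ => ?_⟩
    have h1 : ¬ d - (π.top u : ℕ) < d - (π₀.top u : ℕ) := h π hπ
    omega
  refine ⟨π₀.top u, ClosedExcept.forall_of_exists hM ⟨π₀, h₀, rfl⟩ fun π hπ hp => ⟨?_, fun _ => hp⟩⟩
  have h1 := hmax _ (hM.1.2 π hπ).1
  have h2 := hu π hπ
  rw [Ne, eq_lastTop_iff] at h2
  rw [top_rauzyBot] at *
  split_ifs at * <;> omega

/-- Let `M` be minimal among the sets invariant under `R^b`, and under `R^t` unless the last top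
letter lies in `E`. If no prefix of the top row longer than `s` becomes a prefix of the bottom row
when the letters of `E` are added, then every letter far enough to the right in the bottom row is
the last bottom letter somewhere in `M`. -/
theorem ClosedExcept.exists_lastBot_eq [Fintype A] [DecidableEq A] {E : Finset A}
    {M : Set (CombDatum A d)} (hM : Minimal (ClosedExcept (E : Set A)) M) {s : ℕ}
    (hE : ∀ a ∈ E, ∃ π ∈ M, a = π.lastTop)
    (hlow : ∀ π ∈ M, ∀ a ∈ E, (π.bot a : ℕ) < s + E.card)
    (hirr : ∀ π ∈ M, ∀ k, s < k → k + E.card < d →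
      ¬ ∀ a, (π.bot a : ℕ) < k + E.card ↔ (π.top a : ℕ) < k ∨ a ∈ E)
    {α : A} (hα : ∀ π ∈ M, s + E.card < π.bot α) : ∃ π ∈ M, α = π.lastBot := by
  by_contra! hno
  obtain ⟨π, hπ⟩ := hM.1.1
  classical
  -- `u` is the rightmost letter, in the bottom row of `π`, that is never last there; its position
  -- `m` is constant on `M`.
  obtain ⟨u, hu, humax⟩ := Finset.exists_max_image
    (Finset.univ.filter fun a => ∀ π ∈ M, a ≠ π.lastBot) (fun a => (π.bot a : ℕ))
    ⟨α, by simpa using hno⟩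
  simp only [Finset.mem_filter, Finset.mem_univ, true_and] at hu humax
  obtain ⟨m, hm⟩ := ClosedExcept.bot_const hM hu
  rw [hm π hπ] at humax
  have hmd : m + 1 < d := by
    have h1 := hu π hπ
    rw [Ne, eq_lastBot_iff] at h1
    have := hm π hπ
    have := (π.bot u).2
    omega
  have hsm : s + E.card < m := (hα π hπ).trans_le (humax α hno)
  -- Since `u` never moves, no required `R^t` inserts a letter in front of it; hence the letters
  -- before `u` stay before it and, outside `E`, are never last on top.
  have hwin : ∀ ρ ∈ M, ρ.lastTop ∉ (E : Set A) → m ≤ ρ.bot ρ.lastTop := by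
    intro ρ hρ hl
    have h1 := hm _ ((hM.1.2 ρ hρ).2 hl)
    rw [bot_rauzyTop, hm ρ hρ] at h1
    split_ifs at h1 <;> omega
  have hN : ∀ a, (π.bot a : ℕ) < m → a ∉ E → ∀ ρ ∈ M, a ≠ ρ.lastTop := by
    intro a ha haE ρ hρ e
    have h1 : ∀ ρ ∈ M, (ρ.bot a : ℕ) < m := by
      refine ClosedExcept.forall_of_exists hM ⟨π, hπ, ha⟩ fun σ hσ hp => ⟨hp, fun hl => ?_⟩
      have := hwin σ hσ hl
      rw [bot_rauzyTop]
      split_ifs <;> omega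
    have h2 := h1 ρ hρ
    have h3 := hwin ρ hρ (by rwa [← e])
    rw [← e] at h3
    omega
  have cardQ : ∀ k, E.card + s < k → k < d →
      ((Finset.univ.filter fun a => (π.bot a : ℕ) < k) \ E).card = k - E.card := by
    intro k hk hkd
    rw [Finset.card_sdiff_of_subset, card_prefix π.bot hkd.le]
    intro a ha
    have := hlow π hπ a ha
    simp only [Finset.mem_filter, Finset.mem_univ, true_and]
    omega
  obtain ⟨v, hv, hvmax⟩ := Finset.exists_max_image
    (Finset.univ.filter fun a => ∀ π ∈ M, a ≠ π.lastTop) (fun a => (π.top a : ℕ)) (by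
      have : ((Finset.univ.filter fun a => (π.bot a : ℕ) < m) \ E).Nonempty := by
        rw [← Finset.card_pos, cardQ m (by omega) (by omega)]
        omega
      obtain ⟨a, ha⟩ := this
      simp only [Finset.mem_sdiff, Finset.mem_filter, Finset.mem_univ, true_and] at ha
      exact ⟨a, by simpa using hN a ha.1 ha.2⟩)
  simp only [Finset.mem_filter, Finset.mem_univ, true_and] at hv hvmax
  obtain ⟨n, hn⟩ := ClosedExcept.top_const hM hv
  rw [hn π hπ] at hvmax
  have hnd : n + 1 < d := by
    have h1 := hv π hπ
    rw [Ne, eq_lastTop_iff] at h1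
    have := hn π hπ
    have := (π.top v).2
    omega
  have hwin' : ∀ ρ ∈ M, n ≤ ρ.top ρ.lastBot := by
    intro ρ hρ
    have h1 := hn _ (hM.1.2 ρ hρ).1
    rw [top_rauzyBot, hn ρ hρ] at h1
    split_ifs at h1 <;> omega
  have hconst : ∀ a, (π.top a : ℕ) < n → ∀ ρ ∈ M, (ρ.top a : ℕ) < n := by
    intro a ha
    refine ClosedExcept.forall_of_exists hM ⟨π, hπ, ha⟩ fun σ hσ hp => ⟨?_, fun _ => hp⟩
    have := hwin' σ hσ
    rw [top_rauzyBot]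
    split_ifs <;> omega
  have hQP : ∀ a, (π.bot a : ℕ) < m → a ∉ E → (π.top a : ℕ) < n + 1 := fun a ha haE =>
    Nat.lt_succ_of_le (hvmax a (hN a ha haE))
  have hPQ : ∀ a, (π.top a : ℕ) < n → (π.bot a : ℕ) < m + 1 ∧ a ∉ E := by
    intro a ha
    refine ⟨Nat.lt_succ_of_le (humax a fun ρ hρ e => ?_), fun haE => ?_⟩
    · have := hconst a ha ρ hρ
      have := hwin' ρ hρ
      rw [← e] at this
      omega
    -- Letters before `v` on top remain there, whereas each letter of `E` is last on top somewhere.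
    · obtain ⟨ρ, hρ, e⟩ := hE a haE
      have := hconst a ha ρ hρ
      rw [eq_lastTop_iff] at e
      omega
  -- Both sets have `k` elements, so either inclusion is an equality, which `hirr` forbids.
  have fin1 : ∀ k, s < k → k + E.card < d →
      (∀ a, (π.bot a : ℕ) < k + E.card → a ∉ E → (π.top a : ℕ) < k) → False := by
    intro k hk hkd h
    have heq := Finset.eq_of_subset_of_card_le
      (s := (Finset.univ.filter fun a => (π.bot a : ℕ) < k + E.card) \ E)
      (t := Finset.univ.filter fun a => (π.top a : ℕ) < k)
      (fun a ha => by
        simp only [Finset.mem_sdiff, Finset.mem_filter, Finset.mem_univ, true_and] at ha ⊢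
        exact h a ha.1 ha.2)
      (by rw [card_prefix π.top (by omega), cardQ _ (by omega) hkd]; omega)
    refine hirr π hπ k hk hkd fun a => ?_
    have ha := Finset.ext_iff.1 heq a
    simp only [Finset.mem_sdiff, Finset.mem_filter, Finset.mem_univ, true_and] at ha
    by_cases haE : a ∈ E
    · have := hlow π hπ a haE
      simp only [haE, or_true, iff_true]
      omega
    · simpa [haE] using ha
  have fin2 : ∀ k, s < k → k + E.card < d →
      (∀ a, (π.top a : ℕ) < k → (π.bot a : ℕ) < k + E.card ∧ a ∉ E) → False := by
    intro k hk hkd h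
    have heq := Finset.eq_of_subset_of_card_le
      (t := (Finset.univ.filter fun a => (π.bot a : ℕ) < k + E.card) \ E)
      (s := Finset.univ.filter fun a => (π.top a : ℕ) < k)
      (fun a ha => by
        simp only [Finset.mem_sdiff, Finset.mem_filter, Finset.mem_univ, true_and] at ha ⊢
        exact h a ha)
      (by rw [card_prefix π.top (by omega), cardQ _ (by omega) hkd]; omega)
    refine fin1 k hk hkd fun a h1 h2 => ?_
    have ha := Finset.ext_iff.1 heq a
    simp only [Finset.mem_sdiff, Finset.mem_filter, Finset.mem_univ, true_and] at ha
    exact ha.2 ⟨h1, h2⟩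
  have hle1 : m - E.card ≤ n + 1 := by
    rw [← cardQ m (by omega) (by omega), ← card_prefix π.top hnd.le]
    refine Finset.card_le_card fun a ha => ?_
    simp only [Finset.mem_sdiff, Finset.mem_filter, Finset.mem_univ, true_and] at ha ⊢
    exact hQP a ha.1 ha.2
  have hle2 : n ≤ m + 1 - E.card := by
    rw [← cardQ (m + 1) (by omega) (by omega), ← card_prefix π.top (k := n) (by omega)]
    refine Finset.card_le_card fun a ha => ?_
    simp only [Finset.mem_sdiff, Finset.mem_filter, Finset.mem_univ, true_and] at ha ⊢
    exact hPQ a ha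
  obtain h | h | h : n + 1 + E.card = m ∨ n + E.card = m + 1 ∨ n + E.card = m := by omega
  · exact fin1 (n + 1) (by omega) (by omega) fun a h1 h2 => hQP a (by omega) h2
  · exact fin2 n (by omega) (by omega) fun a h1 => by rw [h]; exact hPQ a h1
  · by_cases hall : ∀ a, (π.top a : ℕ) < n → (π.bot a : ℕ) < m
    · exact fin2 n (by omega) (by omega) fun a h1 => ⟨by rw [h]; exact hall a h1, (hPQ a h1).2⟩
    -- The letter `a` found here occupies bottom position `m`, so adding that position keeps the
    -- bottom prefix, outside `E`, within the top prefix of length `n + 1`.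
    · push Not at hall
      obtain ⟨a, ha1, ha2⟩ := hall
      have ha3 := (hPQ a ha1).1
      refine fin1 (n + 1) (by omega) (by omega) fun c h1 h2 => ?_
      rcases Nat.lt_or_ge (π.bot c : ℕ) m with h3 | h3
      · exact hQP c h3 h2
      · rw [π.bot_inj (a := c) (c := a) (by omega)]
        omega

/-- The case `E = ∅`, `s = 0`: the class is itself a minimal closed set, and the forbidden
splittings are those excluded by admissibility. -/
theorem IsRauzyClass.exists_lastBot_eq {R : Set (CombDatum A d)} (hR : IsRauzyClass R) {a : A}
    (ha : ∀ π ∈ R, (π.bot a : ℕ) ≠ 0) : ∃ π ∈ R, a = π.lastBot := by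
  classical
  obtain ⟨π₀, h₀⟩ := hR.prop.1
  have : Fintype A := Fintype.ofEquiv _ π₀.top.symm
  have hM : Minimal (ClosedExcept ((∅ : Finset A) : Set A)) R := by
    refine ⟨⟨hR.prop.1, fun π h => ⟨hR.rauzyBot_mem h, fun _ => hR.rauzyTop_mem h⟩⟩, ?_⟩
    intro S hS hSR
    exact hR.2 ⟨hS.1, fun π h => hR.admissible (hSR h), fun π h =>
      ⟨(hS.2 π h).2 (by simp), (hS.2 π h).1⟩⟩ hSR
  refine ClosedExcept.exists_lastBot_eq hM (s := 0) (by simp) (by simp) ?_ ?_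
  · intro π hπ k hk hkd h
    exact (hR.admissible hπ).not_prefix hk (by simpa using hkd) (by simpa using h)
  · intro π hπ
    have := ha π hπ
    simp only [Finset.card_empty]
    omega

theorem IsRauzyClass.exists_lastTop_eq {R : Set (CombDatum A d)} (hR : IsRauzyClass R) {a : A}
    (ha : ∀ π ∈ R, (π.top a : ℕ) ≠ 0) : ∃ π ∈ R, a = π.lastTop := by
  obtain ⟨π, hπ, h⟩ := hR.swap.exists_lastBot_eq (a := a) fun π hπ => ha _ hπ
  exact ⟨π.swap, hπ, h⟩

/-! ### Crossing data and their extremal elements -/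

namespace CombDatum

/-- Neither of the sets of letters before `α` in the top row and before `β` in the bottom row
contains the other. -/
def Crossing (α β : A) (π : CombDatum A d) : Prop :=
  (∃ a, (π.bot a : ℕ) < π.bot β ∧ (π.top α : ℕ) ≤ π.top a) ∧
    ∃ c, (π.top c : ℕ) < π.top α ∧ (π.bot β : ℕ) ≤ π.bot c

theorem Crossing.swap {α β : A} {π : CombDatum A d} (h : π.Crossing α β) :
    π.swap.Crossing β α := ⟨h.2, h.1⟩

end CombDatum

theorem IsRauzyClass.first_ne {R : Set (CombDatum A d)} (hR : IsRauzyClass R) {X Y : A}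
    (hX : ∀ π ∈ R, (π.top X : ℕ) = 0) (hY : ∀ π ∈ R, (π.bot Y : ℕ) = 0) : X ≠ Y := by
  rintro rfl
  obtain ⟨π, hπ⟩ := hR.prop.1
  have hd := π.two_le
  refine (hR.admissible hπ).not_prefix (k := 1) (by omega) (by omega) fun a => ?_
  have h1 := hX π hπ
  have h2 := hY π hπ
  constructor <;> intro h
  · rw [π.bot_inj (a := a) (c := X) (by omega)]
    omega
  · rw [π.top_inj (a := a) (c := X) (by omega)]
    omega

/-- Without crossing data, the letters before `β` in the bottom row cannot all come before `α` in
the top row. -/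
theorem IsRauzyClass.not_forall_before {R : Set (CombDatum A d)} (hR : IsRauzyClass R) {X Y : A}
    (hX : ∀ π ∈ R, (π.top X : ℕ) = 0) (hY : ∀ π ∈ R, (π.bot Y : ℕ) = 0) {α β : A} (hβ : β ≠ Y)
    (hc : ∀ π ∈ R, ¬ π.Crossing α β) {π : CombDatum A d} (hπ : π ∈ R) :
    ¬ ∀ a, (π.bot a : ℕ) < π.bot β → (π.top a : ℕ) < π.top α := by
  intro h
  have key : ∀ π ∈ R, ∀ a, (π.bot a : ℕ) < π.bot β → (π.top a : ℕ) < π.top α := by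
    refine hR.forall_of_exists ⟨π, hπ, h⟩ fun ρ hρ hp => ⟨?_, ?_⟩
    -- The last top letter is not before `α`, hence not before `β`; so `R^t` inserts behind `β` and
    -- leaves the letters before `β` unchanged.
    · have h1 : (ρ.bot β : ℕ) ≤ ρ.bot ρ.lastTop := by
        by_contra hlt
        have := hp ρ.lastTop (by omega)
        have := ρ.top_lastTop
        have := (ρ.top α).2
        omega
      have h2 : (ρ.bot β : ℕ) + 1 ≠ d := by
        intro e
        have hne := (hR.admissible hρ).lastTop_ne_lastBot
        rw [Ne, eq_lastBot_iff] at hne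
        have := (ρ.bot ρ.lastTop).2
        omega
      intro a ha
      rw [top_rauzyTop]
      refine hp a ?_
      rw [bot_rauzyTop, bot_rauzyTop] at ha
      split_ifs at ha <;> omega
    · have hne := (hR.admissible hρ).lastTop_ne_lastBot
      rw [ne_comm, Ne, eq_lastTop_iff] at hne
      -- Only when `α` is last can `R^b` shrink the set before `α`. If the inclusion were lost then,
      -- the last bottom letter would complete a crossing.
      by_cases hl : (ρ.top α : ℕ) + 1 = d
      · by_contra hn
        push Not at hn
        refine hc _ (hR.rauzyBot_mem hρ) ⟨hn, ρ.lastBot, ?_, ?_⟩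
        · have := (ρ.top ρ.lastBot).2
          rw [top_rauzyBot, top_rauzyBot]
          split_ifs <;> omega
        · rw [bot_rauzyBot]
          have := ρ.bot_lastBot
          have := (ρ.bot β).2
          omega
      · intro a ha
        have h1 := hp a ha
        have := (ρ.top a).2
        have := (ρ.top α).2
        rw [top_rauzyBot, top_rauzyBot]
        split_ifs <;> omega
  -- `Y` is always before `β` below, so it cannot be last on top.
  obtain ⟨ρ, hρ, e⟩ := hR.exists_lastTop_eq (a := Y) fun ρ hρ h0 =>
    hR.first_ne hX hY (ρ.top_inj ((hX ρ hρ).trans h0.symm))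
  have h1 := key ρ hρ Y (by
    have h1 := hY ρ hρ
    have : (ρ.bot β : ℕ) ≠ ρ.bot Y := fun h => hβ (ρ.bot_inj h)
    omega)
  rw [eq_lastTop_iff] at e
  omega

theorem IsRauzyClass.exists_crossing {R : Set (CombDatum A d)} (hR : IsRauzyClass R) {X Y : A}
    (hX : ∀ π ∈ R, (π.top X : ℕ) = 0) (hY : ∀ π ∈ R, (π.bot Y : ℕ) = 0) {α β : A} (hβ : β ≠ Y)
    (hα : α ≠ X) : ∃ π ∈ R, π.Crossing α β := by
  by_contra! hc
  obtain ⟨π, hπ⟩ := hR.prop.1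
  have h1 := hR.not_forall_before hX hY hβ hc hπ
  have h2 := hR.swap.not_forall_before (α := β) (β := α) (X := Y) (Y := X)
    (fun ρ hρ => hY _ hρ) (fun ρ hρ => hX _ hρ) hα (fun ρ hρ h => hc _ hρ h.swap)
    (π := π.swap) hπ
  push Not at h1 h2
  exact hc π hπ ⟨h1, h2⟩

/-- Among the crossing data of a Rauzy class, one that is extremal for the positions of `α` and
`β` has equal sets of letters before `α` and `β`, up to one letter on each side, unless the letters
`α` and `β` are the last ones in their rows somewhere in the class. -/
theorem IsRauzyClass.exists_maximal_crossing {R : Set (CombDatum A d)} (hR : IsRauzyClass R)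
    {X Y : A} (hX : ∀ π ∈ R, (π.top X : ℕ) = 0) (hY : ∀ π ∈ R, (π.bot Y : ℕ) = 0) {α β : A}
    (hβ : β ≠ Y) (hα : α ≠ X) (hlast : ∀ π ∈ R, ¬ (α = π.lastTop ∧ β = π.lastBot)) :
    ∃ π ∈ R, (∀ ρ ∈ R, ρ.Crossing α β → (ρ.top α : ℕ) ≤ π.top α) ∧ α ≠ π.lastTop ∧
      (π.bot π.lastTop : ℕ) < π.bot β ∧ (π.top π.lastBot : ℕ) < π.top α ∧
      ∀ a, a ≠ π.lastTop → a ≠ π.lastBot →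
        ((π.bot a : ℕ) < π.bot β ↔ (π.top a : ℕ) < π.top α) := by
  -- The weight encodes the lexicographic order, as the position of `β` is below `d`.
  obtain ⟨π₀, ⟨h₀, hc₀⟩, hmax⟩ : ∃ π₀ ∈ {π | π ∈ R ∧ π.Crossing α β},
      ∀ ρ ∈ {π | π ∈ R ∧ π.Crossing α β},
        d * (ρ.top α : ℕ) + ρ.bot β ≤ d * (π₀.top α : ℕ) + π₀.bot β := by
    obtain ⟨π₀, h₀, h⟩ := WellFounded.has_min
      (measure fun π : CombDatum A d => d * d + d - (d * (π.top α : ℕ) + π.bot β)).wf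
      {π | π ∈ R ∧ π.Crossing α β} (hR.exists_crossing hX hY hβ hα)
    refine ⟨π₀, h₀, fun ρ hρ => ?_⟩
    have h1 : ¬ d * d + d - (d * (ρ.top α : ℕ) + ρ.bot β) <
      d * d + d - (d * (π₀.top α : ℕ) + π₀.bot β) := h ρ hρ
    have h2 := (ρ.bot β).2
    have h3 := Nat.mul_le_mul_left d (ρ.top α).2.le
    omega
  set μ := d * (π₀.top α : ℕ) + π₀.bot β with hμ
  have hmax' : ∀ ρ ∈ R, ρ.Crossing α β → d * (ρ.top α : ℕ) + ρ.bot β ≤ μ :=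
    fun ρ h1 h2 => hmax ρ ⟨h1, h2⟩
  clear hmax
  -- Here `R^t` pushes `β` one step right. A letter of P \ Q other than the last bottom one would
  -- keep the datum crossing, against maximality.
  have growT : ∀ π ∈ R, d * (π.top α : ℕ) + π.bot β = μ → (π.bot π.lastTop : ℕ) < π.bot β →
      β ≠ π.lastBot → ∀ c, (π.top c : ℕ) < π.top α → (π.bot β : ℕ) ≤ π.bot c → c = π.lastBot := by
    intro π hπ he h1 h2 c hc1 hc2
    by_contra hne
    rw [Ne, eq_lastBot_iff] at h2
    rw [eq_lastBot_iff] at hne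
    have hb := bot_rauzyTop π
    have e1 : (π.rauzyTop.bot β : ℕ) = π.bot β + 1 := by
      rw [hb, if_neg (by omega), if_neg h2]
    have := hmax' _ (hR.rauzyTop_mem hπ) ⟨⟨π.lastTop, ?_, ?_⟩, c, ?_, ?_⟩
    · rw [e1, top_rauzyTop] at this
      omega
    · rw [e1, hb, if_pos le_rfl]
      omega
    · rw [top_rauzyTop]
      have := π.top_lastTop
      have := (π.top α).2
      omega
    · exact hc1
    · rw [e1, hb, if_neg (by omega), if_neg hne]
      omega
  have growB : ∀ π ∈ R, d * (π.top α : ℕ) + π.bot β = μ → (π.top π.lastBot : ℕ) < π.top α →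
      α ≠ π.lastTop → ∀ c, (π.bot c : ℕ) < π.bot β → (π.top α : ℕ) ≤ π.top c → c = π.lastTop := by
    intro π hπ he h1 h2 c hc1 hc2
    by_contra hne
    rw [Ne, eq_lastTop_iff] at h2
    rw [eq_lastTop_iff] at hne
    have hb := top_rauzyBot π
    have e1 : (π.rauzyBot.top α : ℕ) = π.top α + 1 := by
      rw [hb, if_neg (by omega), if_neg h2]
    have := hmax' _ (hR.rauzyBot_mem hπ) ⟨⟨c, ?_, ?_⟩, π.lastBot, ?_, ?_⟩
    · rw [e1, bot_rauzyBot, mul_add] at this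
      have := π.two_le
      omega
    · exact hc1
    · rw [e1, hb, if_neg (by omega), if_neg hne]
      omega
    · rw [e1, hb, if_pos le_rfl]
      omega
    · rw [bot_rauzyBot]
      have := π.bot_lastBot
      have := (π.bot β).2
      omega
  obtain ⟨π, hπ, hcr, hπμ, hx, hy⟩ : ∃ π ∈ R, π.Crossing α β ∧
      d * (π.top α : ℕ) + π.bot β = μ ∧ (π.bot π.lastTop : ℕ) < π.bot β ∧
      (π.top π.lastBot : ℕ) < π.top α := by
    by_contra! hno
    obtain ⟨a, ha1, ha2⟩ := hc₀.1
    have haX : ∀ π ∈ R, (π.top a : ℕ) ≠ 0 := by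
      intro π hπ h
      obtain rfl : a = X := π.top_inj (h.trans (hX π hπ).symm)
      have h1 := hX π₀ h₀
      exact hα (π₀.top_inj (by omega))
    -- If no extremal crossing datum has x in Q and y in P, then `growT` and `growB` exclude each of
    -- the two separately. Both operations then preserve P, Q and the weight, so `a` stays in Q
    -- throughout the class, even where it is last on top.
    have key : ∀ π ∈ R, (π.Crossing α β ∧ d * (π.top α : ℕ) + π.bot β = μ) ∧
        (π.bot a : ℕ) < π.bot β := by
      refine hR.forall_of_exists ⟨π₀, h₀, ⟨hc₀, rfl⟩, ha1⟩ ?_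
      rintro π hπ ⟨⟨hcr, he⟩, ha⟩
      obtain ⟨⟨p, hp1, hp2⟩, c, hc1, hc2⟩ := hcr
      have hne := (hR.admissible hπ).lastTop_ne_lastBot
      have hx : (π.bot β : ℕ) ≤ π.bot π.lastTop := by
        by_contra hx
        have hy := hno π hπ ⟨⟨p, hp1, hp2⟩, c, hc1, hc2⟩ he (by omega)
        have h1 : β ≠ π.lastBot := by
          intro e
          rw [eq_lastBot_iff] at e
          have := (π.bot c).2
          rw [π.bot_inj (a := c) (c := π.lastBot) (by have := π.bot_lastBot; omega)] at hc1
          omega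
        have := growT π hπ he (by omega) h1 c hc1 hc2
        rw [this] at hc1
        omega
      have hy : (π.top α : ℕ) ≤ π.top π.lastBot := by
        by_contra hy
        have h1 : α ≠ π.lastTop := by
          intro e
          rw [eq_lastTop_iff] at e
          have := (π.top p).2
          rw [π.top_inj (a := p) (c := π.lastTop) (by have := π.top_lastTop; omega)] at hp1
          omega
        have := growB π hπ he (by omega) h1 p hp1 hp2
        rw [this] at hp1
        omega
      have hβl : (π.bot β : ℕ) + 1 ≠ d := by
        intro e
        rw [Ne, eq_lastBot_iff] at hne
        have := (π.bot π.lastTop).2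
        omega
      have hαl : (π.top α : ℕ) + 1 ≠ d := by
        intro e
        rw [ne_comm, Ne, eq_lastTop_iff] at hne
        have := (π.top π.lastBot).2
        omega
      have hb : ∀ l, (π.rauzyTop.bot l : ℕ) < π.rauzyTop.bot β ↔ (π.bot l : ℕ) < π.bot β := by
        intro l
        rw [bot_rauzyTop, bot_rauzyTop]
        split_ifs <;> omega
      have ht : ∀ l, (π.rauzyBot.top l : ℕ) < π.rauzyBot.top α ↔ (π.top l : ℕ) < π.top α := by
        intro l
        rw [top_rauzyBot, top_rauzyBot]
        split_ifs <;> omega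
      have hbβ : (π.rauzyTop.bot β : ℕ) = π.bot β := by rw [bot_rauzyTop, if_pos hx]
      have htα : (π.rauzyBot.top α : ℕ) = π.top α := by rw [top_rauzyBot, if_pos hy]
      refine ⟨⟨⟨⟨⟨p, ?_, hp2⟩, c, hc1, ?_⟩, ?_⟩, ?_⟩, ⟨⟨⟨p, hp1, ?_⟩, c, ?_, hc2⟩, ?_⟩, ha⟩
      · rwa [hb]
      · rwa [← not_lt, hb, not_lt]
      · rwa [hbβ, top_rauzyTop]
      · rwa [hb]
      · rwa [← not_lt, ht, not_lt]
      · rwa [ht]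
      · rwa [htα, bot_rauzyBot]
    obtain ⟨π, hπ, e⟩ := hR.exists_lastTop_eq haX
    obtain ⟨⟨h1, h2⟩, h3⟩ := key π hπ
    have h4 := hno π hπ h1 h2 (by rwa [← e])
    obtain ⟨⟨p, hp1, hp2⟩, c, hc1, hc2⟩ := h1
    have h5 : β ≠ π.lastBot := by
      intro e
      rw [eq_lastBot_iff] at e
      have := (π.bot c).2
      rw [π.bot_inj (a := c) (c := π.lastBot) (by have := π.bot_lastBot; omega)] at hc1
      omega
    have := growT π hπ h2 (by rwa [← e]) h5 c hc1 hc2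
    rw [this] at hc1
    omega
  have hαx : α ≠ π.lastTop := by
    intro e
    have hβy : β ≠ π.lastBot := fun e' => hlast π hπ ⟨e, e'⟩
    have hne : β ≠ α := by
      rintro rfl
      rw [← e] at hx
      omega
    have h1 : (π.top β : ℕ) < π.top α := by
      have h2 : (π.top β : ℕ) ≠ π.top α := fun h => hne (π.top_inj h)
      have := (π.top β).2
      rw [eq_lastTop_iff] at e
      omega
    exact hβy (growT π hπ hπμ hx hβy β h1 le_rfl)
  have hplus := growB π hπ hπμ hy hαx
  have hβy : β ≠ π.lastBot := by
    intro e
    refine hαx (hplus α ?_ le_rfl)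
    have h2 : (π.bot α : ℕ) ≠ π.bot β := fun h => by
      rw [π.bot_inj h, e] at hy
      omega
    have := (π.bot α).2
    rw [eq_lastBot_iff] at e
    omega
  have hminus := growT π hπ hπμ hx hβy
  refine ⟨π, hπ, fun ρ hρ hc => ?_, hαx, hx, hy, fun a h1 h2 => ⟨fun h => ?_, fun h => ?_⟩⟩
  · have h1 := hmax' ρ hρ hc
    rw [← hπμ] at h1
    by_contra hlt
    have h2 : d * ((π.top α : ℕ) + 1) ≤ d * (ρ.top α : ℕ) := Nat.mul_le_mul_left d (by omega)
    have := (π.bot β).2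
    rw [mul_add] at h2
    omega
  · by_contra h3
    exact h1 (hplus a h (by omega))
  · by_contra h3
    exact h2 (hminus a h (by omega))

/-! ### From an extremal crossing to nested prefixes -/

/-- If the rows split once more behind `α` and `β`, then a letter of the last block can be moved in
front of `α`. -/
theorem IsRauzyClass.exists_crossing_of_prefix {R : Set (CombDatum A d)} (hR : IsRauzyClass R)
    {π : CombDatum A d} (hπ : π ∈ R) {α β : A} {s k : ℕ} (hα : (π.top α : ℕ) = s)
    (hβ : (π.bot β : ℕ) = s + 1) (hx : (π.bot π.lastTop : ℕ) < s)
    (hS : ∀ a, (π.bot a : ℕ) < s + 1 ↔ (π.top a : ℕ) < s ∨ a = π.lastTop) (hsk : s < k)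
    (hkd : k + 1 < d) (hk : ∀ a, (π.bot a : ℕ) < k + 1 ↔ (π.top a : ℕ) < k ∨ a = π.lastTop) :
    ∃ ρ ∈ R, ρ.Crossing α β ∧ (ρ.top α : ℕ) = s + 1 := by
  have htx := π.top_lastTop
  set x := π.lastTop with hxdef
  -- Rotate the bottom row until `w` is last, then the top row until `z` is last, then the bottom
  -- row until `c` is last. As `c` precedes `α` on top, a final `R^b` inserts `z` before `α`; `x`
  -- and `c` witness the crossing.
  obtain ⟨w, hw⟩ := π.exists_bot (k := k) (by omega)
  obtain ⟨z, hz⟩ := π.exists_bot (k := d - 1) (by omega)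
  obtain ⟨c, hc⟩ := π.exists_bot (k := s) (by omega)
  have hwx : w ≠ x := by rintro e; rw [e] at hw; omega
  have hzx : z ≠ x := by rintro e; rw [e] at hz; omega
  have hcx : c ≠ x := by rintro e; rw [e] at hc; omega
  have htw : (π.top w : ℕ) < k := ((hk w).1 (by omega)).resolve_right hwx
  have htw' : s ≤ (π.top w : ℕ) := by
    by_contra h
    have := (hS w).2 (Or.inl (by omega))
    omega
  have htz : k ≤ (π.top z : ℕ) := by
    by_contra h
    have := (hk z).2 (Or.inl (by omega))
    omega
  have htz' : (π.top z : ℕ) + 1 < d := by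
    have h1 := (π.top z).2
    have h2 : (π.top z : ℕ) ≠ π.top x := fun h => hzx (π.top_inj h)
    omega
  have htc : (π.top c : ℕ) < s := ((hS c).1 (by omega)).resolve_right hcx
  have hb2 := fun a => π.bot_iterate_rauzyTop a (d - 1 - k) (by rw [← hxdef]; omega)
  have ht2 := π.top_iterate_rauzyTop (d - 1 - k)
  have m2 := hR.iterate_rauzyTop_mem hπ (d - 1 - k)
  rw [← hxdef] at hb2
  generalize rauzyTop^[d - 1 - k] π = π₂ at hb2 ht2 m2
  have l2 : w = π₂.lastBot := by
    rw [eq_lastBot_iff, hb2, hw, if_neg (by omega), if_pos (by omega)]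
    omega
  have ht3 := fun a => π₂.top_iterate_rauzyBot a (d - 1 - π.top z) (by rw [ht2, ← l2]; omega)
  have hb3 := π₂.bot_iterate_rauzyBot (d - 1 - π.top z)
  have m3 := hR.iterate_rauzyBot_mem m2 (d - 1 - π.top z)
  rw [← l2, ht2] at ht3
  generalize rauzyBot^[d - 1 - (π.top z : ℕ)] π₂ = π₃ at ht3 hb3 m3
  have l3 : z = π₃.lastTop := by
    rw [eq_lastTop_iff, ht3, if_neg (by omega), if_pos (by omega)]
    omega
  have bz : (π₂.bot z : ℕ) = π.bot x + (d - 1 - k) := by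
    rw [hb2, hz, if_neg (by omega), if_neg (by omega)]
    omega
  have hb4 := fun a => π₃.bot_iterate_rauzyTop a (k - s) (by rw [hb3, ← l3, bz]; omega)
  have ht4 := π₃.top_iterate_rauzyTop (k - s)
  have m4 := hR.iterate_rauzyTop_mem m3 (k - s)
  rw [← l3, hb3, bz] at hb4
  generalize rauzyTop^[k - s] π₃ = π₄ at hb4 ht4 m4
  have l4 : c = π₄.lastBot := by
    rw [eq_lastBot_iff, hb4, hb2, hc, if_neg (show ¬ s ≤ (π.bot x : ℕ) by omega),
      if_pos (show s + (d - 1 - k) < d by omega), if_neg (by omega), if_pos (by omega)]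
    omega
  have b4β : (π₄.bot β : ℕ) = π.bot x + (d - 1 - k) + 1 := by
    rw [hb4, hb2, hβ, if_neg (show ¬ s + 1 ≤ (π.bot x : ℕ) by omega),
      if_pos (show s + 1 + (d - 1 - k) < d by omega), if_neg (by omega), if_neg (by omega)]
    omega
  have b4x : (π₄.bot x : ℕ) = π.bot x := by
    rw [hb4, hb2, if_pos (le_refl (π.bot x : ℕ)), if_pos (by omega)]
  have b4c : (π₄.bot c : ℕ) + 1 = d := (eq_lastBot_iff _ _).1 l4
  have t4c : (π₄.top c : ℕ) = π.top c := by rw [ht4, ht3, if_pos (by omega)]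
  have t4α : (π₄.top α : ℕ) = s := by rw [ht4, ht3, if_pos (by omega), hα]
  have t4x : s + 1 ≤ (π₄.top x : ℕ) := by
    rw [ht4, ht3, if_neg (by omega), if_neg (by omega)]
    omega
  have t4x' : (π₄.top x : ℕ) + 1 ≠ d := by
    intro h
    rw [ht4, ← eq_lastTop_iff, ← l3] at h
    exact hzx h.symm
  have t5 := π₄.top_rauzyBot
  rw [← l4, t4c] at t5
  have t5α : (π₄.rauzyBot.top α : ℕ) = s + 1 := by
    rw [t5, t4α, if_neg (by omega), if_neg (by omega)]
  refine ⟨π₄.rauzyBot, hR.rauzyBot_mem m4, ⟨⟨x, ?_, ?_⟩, c, ?_, ?_⟩, t5α⟩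
  · rw [bot_rauzyBot, b4β, b4x]
    omega
  · rw [t5α, t5, if_neg (by omega), if_neg t4x']
    omega
  · rw [t5α, t5, t4c, if_pos le_rfl]
    omega
  · rw [bot_rauzyBot, b4β]
    omega

/-- If two sets of letters at the beginning of the rows differ by one letter `x` not in the upper
one and the rows do not split further, then `α` can be made the last letter of the bottom row and
`x` the last letter of the top row. -/
theorem IsRauzyClass.exists_last_of_irreducible {R : Set (CombDatum A d)} (hR : IsRauzyClass R)
    {π : CombDatum A d} (hπ : π ∈ R) {α β x : A} {s : ℕ} (hα : (π.top α : ℕ) = s)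
    (hβ : (π.bot β : ℕ) = s + 1) (hαx : α ≠ x) (hx : s ≤ (π.top x : ℕ))
    (hS : ∀ a, (π.bot a : ℕ) < s + 1 ↔ (π.top a : ℕ) < s ∨ a = x)
    (hirr : ∀ k, s < k → k + 1 < d → ¬ ∀ a, (π.bot a : ℕ) < k + 1 ↔ (π.top a : ℕ) < k ∨ a = x) :
    ∃ ρ ∈ R, (ρ.top α : ℕ) = s ∧ (ρ.bot β : ℕ) = s + 1 ∧
      (∀ a, (ρ.bot a : ℕ) < s + 1 ↔ (ρ.top a : ℕ) < s ∨ a = x) ∧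
      x = ρ.lastTop ∧ α = ρ.lastBot := by
  classical
  have hsd : s + 1 < d := by have := (π.bot β).2; omega
  set Q : Set (CombDatum A d) := {ρ | ρ ∈ R ∧ (ρ.top α : ℕ) = s ∧ (ρ.bot β : ℕ) = s + 1 ∧
    (∀ a, (ρ.top a : ℕ) < s ↔ (π.top a : ℕ) < s) ∧
    (∀ a, (ρ.bot a : ℕ) < s + 1 ↔ (π.top a : ℕ) < s ∨ a = x) ∧
    ∀ k, s < k → k + 1 < d → ¬ ∀ a, (ρ.bot a : ℕ) < k + 1 ↔ (ρ.top a : ℕ) < k ∨ a = x} with hQ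
  have hπQ : π ∈ Q := ⟨hπ, hα, hβ, fun _ => Iff.rfl, hS, hirr⟩
  have hbα : ∀ ρ ∈ Q, s + 1 ≤ (ρ.bot α : ℕ) := by
    rintro ρ ⟨-, -, -, -, h5, -⟩
    by_contra h
    rcases (h5 α).1 (by omega) with h | h
    · omega
    · exact hαx h
  obtain ⟨ρ, ⟨hρ, h1, h2, h3, h4, -⟩, hl⟩ : ∃ ρ ∈ Q, α = ρ.lastBot := by
    by_contra! hno
    have hsd' : s + 2 < d := by
      have h1 := hbα π hπQ
      have h2 := hno π hπQ
      have := (π.bot α).2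
      rw [Ne, eq_lastBot_iff] at h2
      omega
    -- If they coincided, appending this one letter to both prefixes would give a split at `s + 1`.
    have hαβ : α ≠ β := by
      rintro rfl
      refine hirr (s + 1) (by omega) hsd' fun a => ?_
      have h1 := hS a
      by_cases e : a = α
      · subst e
        constructor <;> intro <;> omega
      · have h2 : (π.bot a : ℕ) ≠ s + 1 := fun h => e (π.bot_inj (h.trans hβ.symm))
        have h3 : (π.top a : ℕ) ≠ s := fun h => e (π.top_inj (h.trans hα.symm))
        rw [show (π.bot a : ℕ) < s + 1 + 1 ↔ (π.bot a : ℕ) < s + 1 by omega, h1,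
          show (π.top a : ℕ) < s + 1 ↔ (π.top a : ℕ) < s by omega]
    have hcl : ClosedExcept (({x} : Finset A) : Set A) Q := by
      refine ⟨⟨π, hπQ⟩, fun ρ hρQ => ?_⟩
      obtain ⟨hρ, h1, h2, h3, h4, h5⟩ := id hρQ
      have hlb := ρ.bot_lastBot
      refine ⟨?_, fun hlx => ?_⟩
      · have hw : s < (ρ.top ρ.lastBot : ℕ) := by
          have h6 := hno ρ hρQ
          have h7 := h4 ρ.lastBot
          have h8 := h3 ρ.lastBot
          have h9 : (ρ.top ρ.lastBot : ℕ) ≠ ρ.top α := fun h => h6 (ρ.top_inj h).symm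
          by_contra h
          have := h7.2 (Or.inl (h8.1 (by omega)))
          omega
        have hb := ρ.top_rauzyBot
        refine ⟨hR.rauzyBot_mem hρ, ?_, h2, fun a => ?_, h4, fun k hk hkd h => ?_⟩
        · rw [hb, if_pos (by omega), h1]
        · rw [← h3, hb]
          split_ifs <;> omega
        · refine h5 k hk hkd fun a => ?_
          -- The last bottom letter lies outside the prefixes, so `R^b` inserts behind the top
          -- prefix and the split already existed in `ρ`.
          have h6 := h ρ.lastBot
          rw [hb, if_pos le_rfl, bot_rauzyBot] at h6
          have h7 : ¬ (ρ.top ρ.lastBot : ℕ) < k := fun h => by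
            have := h6.2 (Or.inl h)
            omega
          rw [← bot_rauzyBot, h a, hb]
          refine or_congr_left ?_
          split_ifs <;> omega
      · have hlx' : ρ.lastTop ≠ x := by simpa using hlx
        have hlt := ρ.top_lastTop
        have hw : s + 1 ≤ (ρ.bot ρ.lastTop : ℕ) := by
          by_contra h
          have h6 := ((h4 ρ.lastTop).1 (by omega)).resolve_right hlx'
          rw [← h3] at h6
          omega
        have hb := ρ.bot_rauzyTop
        refine ⟨hR.rauzyTop_mem hρ, h1, ?_, h3, fun a => ?_, fun k hk hkd h => ?_⟩
        · rw [hb, if_pos (by omega), h2]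
        · rw [← h4, hb]
          split_ifs <;> omega
        · refine h5 k hk hkd fun a => ?_
          have h6 := h ρ.lastTop
          rw [hb, if_pos le_rfl, top_rauzyTop] at h6
          have h7 : ¬ (ρ.bot ρ.lastTop : ℕ) < k + 1 := fun h => by
            have := (h6.1 h).resolve_right hlx'
            omega
          rw [← top_rauzyTop, ← h a, hb]
          split_ifs <;> omega
    have : Fintype A := Fintype.ofEquiv _ π.top.symm
    obtain ⟨M, hMQ, hM⟩ := exists_minimal_le_of_wellFoundedLT (ClosedExcept _) Q hcl
    -- Otherwise the exception never occurs, `M` contains the whole class, and `α` is last below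
    -- somewhere because it is never first there.
    have hxl : ∃ ρ ∈ M, x = ρ.lastTop := by
      by_contra! hnx
      obtain ⟨ρ₀, h₀⟩ := hM.1.1
      have hall : ∀ ρ ∈ R, ρ ∈ M :=
        hR.forall_of_exists ⟨ρ₀, (hMQ h₀).1, h₀⟩ fun ρ _ hρ =>
          ⟨(hM.1.2 ρ hρ).2 (by simpa using (hnx ρ hρ).symm), (hM.1.2 ρ hρ).1⟩
      obtain ⟨ρ, hρ, e⟩ := hR.exists_lastBot_eq (a := α) fun ρ hρ => by
        have := hbα ρ (hMQ (hall ρ hρ))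
        omega
      exact hno ρ (hMQ (hall ρ hρ)) e
    obtain ⟨ρ, hρ, e⟩ := ClosedExcept.exists_lastBot_eq hM (s := s) (α := α)
      (by simpa using hxl)
      (fun ρ hρ a ha => by
        rw [Finset.mem_singleton] at ha
        rw [Finset.card_singleton]
        exact ((hMQ hρ).2.2.2.2.1 a).2 (Or.inr ha))
      (fun ρ hρ k h1 h2 h3 => (hMQ hρ).2.2.2.2.2 k h1 (by simpa using h2) (by simpa using h3))
      (fun ρ hρ => by
        rw [Finset.card_singleton]
        have h1 := hbα ρ (hMQ hρ)
        have h2 := (hMQ hρ).2.2.1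
        have h3 : (ρ.bot α : ℕ) ≠ ρ.bot β := fun h => hαβ (ρ.bot_inj h)
        omega)
    exact hno ρ (hMQ hρ) e
  have hxs : s < (ρ.top x : ℕ) := by
    have h5 : (ρ.top x : ℕ) ≠ ρ.top α := fun h => hαx (ρ.top_inj h).symm
    have := h3 x
    omega
  -- With `α` last below, `R^b` rotates only what is behind `α` on top, until `x` is last.
  have ht := fun a => ρ.top_iterate_rauzyBot a (d - 1 - ρ.top x) (by rw [← hl]; omega)
  have hb := ρ.bot_iterate_rauzyBot (d - 1 - ρ.top x)
  have hm := hR.iterate_rauzyBot_mem hρ (d - 1 - ρ.top x)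
  rw [← hl, h1] at ht
  generalize rauzyBot^[d - 1 - (ρ.top x : ℕ)] ρ = σ at ht hb hm
  refine ⟨σ, hm, ?_, ?_, fun a => ?_, ?_, ?_⟩
  · rw [ht, if_pos h1.le, h1]
  · rw [hb, h2]
  · rw [hb, h4, ← h3, ht]
    refine or_congr_left ?_
    split_ifs <;> omega
  · have := (ρ.top x).2
    rw [eq_lastTop_iff, ht, if_neg (by omega), if_pos (by omega)]
    omega
  · rw [eq_lastBot_iff, hb, ← eq_lastBot_iff, ← hl]

theorem IsRauzyClass.exists_nested {R : Set (CombDatum A d)} (hR : IsRauzyClass R)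
    {X Y : A} (hX : ∀ π ∈ R, (π.top X : ℕ) = 0) (hY : ∀ π ∈ R, (π.bot Y : ℕ) = 0) {α β : A}
    (hβ : β ≠ Y) (hα : α ≠ X) (hlast : ∀ π ∈ R, ¬ (α = π.lastTop ∧ β = π.lastBot)) :
    ∃ π ∈ R, ∃ V, (π.top α : ℕ) + 1 = π.bot β ∧
      (∀ a, (π.bot a : ℕ) < π.bot β ↔ (π.top a : ℕ) < π.top α ∨ a = V) ∧
      V = π.lastTop ∧ α = π.lastBot := by
  classical
  obtain ⟨π, hπ, hmax, hαx, hx, hy, hS⟩ := hR.exists_maximal_crossing hX hY hβ hα hlast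
  have : Fintype A := Fintype.ofEquiv _ π.top.symm
  have hne := (hR.admissible hπ).lastTop_ne_lastBot
  have hβy : (π.bot β : ℕ) + 1 ≠ d := by
    intro e
    have h1 : α ≠ π.lastBot := by
      intro h
      rw [← h] at hy
      omega
    have h2 := (π.bot α).2
    have h3 := hS α hαx h1
    rw [Ne, eq_lastBot_iff] at h1
    omega
  have hb := π.bot_rauzyTop
  have hxt := π.top_lastTop
  have hyb := π.bot_lastBot
  have hαd := (π.top α).2
  rw [Ne, eq_lastTop_iff] at hαx
  have hS1 : ∀ a, (π.rauzyTop.bot a : ℕ) < π.rauzyTop.bot β ↔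
      (π.top a : ℕ) < π.top α ∨ a = π.lastTop := by
    intro a
    have e1 : (π.rauzyTop.bot β : ℕ) = π.bot β + 1 := by
      rw [hb, if_neg (by omega), if_neg hβy]
    rw [e1, hb]
    by_cases h1 : a = π.lastTop
    · rw [h1, if_pos le_rfl]
      simp only [or_true, iff_true]
      omega
    by_cases h2 : a = π.lastBot
    · rw [h2]
      simp only [hy, true_or, iff_true]
      split_ifs <;> omega
    have h3 := hS a h1 h2
    rw [eq_lastBot_iff] at h2
    simp only [h1, or_false]
    rw [← h3]
    split_ifs <;> omega
  have hcard : (π.rauzyTop.bot β : ℕ) = π.top α + 1 := by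
    have h1 : (Finset.univ.filter fun a => (π.rauzyTop.bot a : ℕ) < π.rauzyTop.bot β) =
        insert π.lastTop (Finset.univ.filter fun a => (π.top a : ℕ) < π.top α) := by
      ext a
      simp only [Finset.mem_filter, Finset.mem_univ, true_and, Finset.mem_insert]
      rw [hS1, or_comm]
    have h2 := congrArg Finset.card h1
    rw [card_prefix _ (Fin.is_le'), Finset.card_insert_of_notMem, card_prefix _ (Fin.is_le')] at h2
    · exact h2
    · simp only [Finset.mem_filter, Finset.mem_univ, true_and]
      omega
  rw [hcard] at hS1
  -- The moved letter fits between the last top letter and `β`, hence the strict bound.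
  have hxs : (π.rauzyTop.bot π.rauzyTop.lastTop : ℕ) < π.top α := by
    have h1 : (π.rauzyTop.bot π.lastBot : ℕ) = π.bot π.lastTop + 1 := by
      rw [Ne, eq_lastBot_iff] at hne
      have := (π.bot π.lastTop).2
      rw [hb, if_neg (by omega), if_pos hyb]
    have h2 := (hS1 π.lastBot).2 (Or.inl hy)
    rw [lastTop_rauzyTop, hb, if_pos le_rfl]
    omega
  obtain ⟨ρ, hρ, h1, h2, h3, h4, h5⟩ := hR.exists_last_of_irreducible (hR.rauzyTop_mem hπ)
    (α := α) (β := β) (x := π.lastTop) (s := π.top α) rfl hcard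
    (by rwa [Ne, eq_lastTop_iff]) (by rw [top_rauzyTop]; omega) hS1 (by
      intro k hk hkd h
      obtain ⟨ρ, hρ, hc, he⟩ := hR.exists_crossing_of_prefix (hR.rauzyTop_mem hπ) (α := α)
        (β := β) (s := π.top α) rfl hcard hxs hS1 hk hkd h
      have := hmax ρ hρ hc
      omega)
  exact ⟨ρ, hρ, π.lastTop, by omega, by rwa [h1, h2], h4, h5⟩

end

theorem theorem5p1 {A : Type*} {d : ℕ} (R : Set (CombDatum A d)) (hR : IsRauzyClass R)
    (X Y : A) (hX : ∀ π ∈ R, π.t X = 1) (hY : ∀ π ∈ R, π.b Y = 1)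
    (β α : A) (hβ : β ≠ Y) (hα : α ≠ X) :
    (∃ π ∈ R, π.t α = d ∧ π.b β = d) ∨
    (∃ π ∈ R, ∃ π' ∈ R, π ≠ π' ∧ ∃ V V' : A,
      ({ξ : A | π.t ξ < π.t α} ∪ {V} = {ξ : A | π.b ξ < π.b β} ∧ π.t V = d ∧ π.b α = d) ∧
      ({ξ : A | π'.t ξ < π'.t α} = {ξ : A | π'.b ξ < π'.b β} ∪ {V'} ∧
        π'.b V' = d ∧ π'.t β = d)) := by
  have hX' : ∀ π ∈ R, (π.top X : ℕ) = 0 := fun π h => Nat.succ_injective (hX π h)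
  have hY' : ∀ π ∈ R, (π.bot Y : ℕ) = 0 := fun π h => Nat.succ_injective (hY π h)
  rw [or_iff_not_imp_left]
  intro hA
  have hlast : ∀ π ∈ R, ¬ (α = π.lastTop ∧ β = π.lastBot) := by
    rintro π hπ ⟨h1, h2⟩
    exact hA ⟨π, hπ, (CombDatum.eq_lastTop_iff _ _).1 h1, (CombDatum.eq_lastBot_iff _ _).1 h2⟩
  obtain ⟨π, hπ, V, h1, h2, h3, h4⟩ := hR.exists_nested hX' hY' hβ hα hlast
  obtain ⟨π', hπ', V', h1', h2', h3', h4'⟩ := hR.swap.exists_nested (α := β) (β := α) (X := Y)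
    (Y := X) (fun ρ hρ => hY' _ hρ) (fun ρ hρ => hX' _ hρ) hα hβ
    (fun ρ hρ h => hlast _ hρ ⟨h.2, h.1⟩)
  refine ⟨π, hπ, π'.swap, hπ', ?_, V, V', ⟨?_, (CombDatum.eq_lastTop_iff _ _).1 h3,
    (CombDatum.eq_lastBot_iff _ _).1 h4⟩, ?_, (CombDatum.eq_lastTop_iff _ _).1 h3', (CombDatum.eq_lastBot_iff _ _).1 h4'⟩
  -- One datum has `β` one position further than `α`, the other has `α` one further than `β`.
  · rintro rfl
    simp only [CombDatum.swap] at h1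
    omega
  · ext a
    have := h2 a
    simp only [Set.mem_union, Set.mem_ofPred_eq, Set.mem_singleton_iff, CombDatum.t, CombDatum.b, add_lt_add_iff_right]
    exact this.symm
  · ext a
    have := h2' a
    simp only [Set.mem_union, Set.mem_ofPred_eq, Set.mem_singleton_iff, CombDatum.t, CombDatum.b, add_lt_add_iff_right]
    exact this
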